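/- Let $G$ be a finite group and let $R$ be a $G$-Tambara functor such that the restriction $R(G/H)\to R(G/K)$ along every map $G/K\to G/H$ of transitive $G$-sets is injective. Let $G$ act on the commutative ring $R(G/e)$ by restriction along the right multiplications $G/e\to G/e$. For a commutative ring $S$ with $G$-action let $\mathrm{FP}(S)$ be the fixed-point $G$-Tambara functor, $\mathrm{FP}(S)(G/H)=S^H$ (more generally $\mathrm{FP}(S)(X)=\mathrm{Map}_G(X,S)$), with restrictions the inclusions and transfers and norms given by sums and products over cosets. Let $f\colon R\to \mathrm{FP}(R(G/e))$ be the unit of the adjunction between evaluation at $G/e$ and $\mathrm{FP}$; at level $G/H$ it is the restriction $R(G/H)\to R(G/e)^H$ along $G/e\to G/H$. A Tambara ideal $I$ of a $G$-Tambara functor $T$ is a family of ideals $I(G/H)\subseteq T(G/H)$, $H\le G$, closed under restrictions, transfers, norms and conjugations; the product $I\cdot J$ is the smallest Tambara ideal containing all $I(G/H)\cdot J(G/H)$. A Tambara ideal $\mathfrak p\neq T$ is prime if $I\cdot J\subseteq\mathfrak p$ implies $I\subseteq \mathfrak p$ or $J\subseteq\mathfrak p$. The Nakaoka spectrum $\mathrm{Spec}(T)$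 is the set of prime Tambara ideals, ordered by inclusion, with the topology generated by the closed sets $V(I)=\{\mathfrak p : I\subseteq\mathfrak p\}$, where $I$ runs through the Tambara ideals of $T$. Then contraction $\mathfrak q\mapsto f^{-1}(\mathfrak q)$ is a well-defined continuous bijection $$\mathrm{Spec}(\mathrm{FP}(R(G/e)))\longrightarrow \mathrm{Spec}(R).$$ Hence there is an isomorphism of posets $\mathrm{Spec}(R)\cong \mathrm{Spec}(R(G/e)^G)$, where the right-hand side is the set of prime ideals of the ring $R(G/e)^G$ ordered by inclusion; it is given by $\mathfrak p\mapsto \mathfrak p(G/e)\cap R(G/e)^G$. -/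

import Mathlib

universe u v w

noncomputable section

/-! ## Finite `G`-sets -/

/-- A finite `G`-set. -/
structure FinGSet (G : Type u) [Group G] where
  carrier : Type u
  [action : MulAction G carrier]
  [finite : Finite carrier]

namespace FinGSet

variable {G : Type u} [Group G]

instance : CoeSort (FinGSet G) (Type u) := ⟨FinGSet.carrier⟩

instance (X : FinGSet G) : MulAction G X := X.action

instance (X : FinGSet G) : Finite X := X.finite

/-- The transitive `G`-set `G/H`. -/
def orbit [Finite G] (H : Subgroup G) : FinGSet G where
  carrier := G ⧸ H

/-- A commutative square `f ∘ p = g ∘ q` of finite `G`-sets which is cartesian. -/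
structure IsPullback {W X Y Z : FinGSet G} (p : W →[G] X) (q : W →[G] Y)
    (f : X →[G] Z) (g : Y →[G] Z) : Prop where
  comm : ∀ w, f (p w) = g (q w)
  existsUnique : ∀ x y, f x = g y → ∃! w, p w = x ∧ q w = y

/-- An exponential diagram
`X ←f- A ←e- W -p→ P -q→ Y` over `g : X → Y`: the set `P` over `Y` is the dependent product
`Π_g A`, whose fibre over `y` consists of the sections `s : g⁻¹(y) → A` of `f`, the set `W` is
`X ×_Y Π_g A`, and `e` is the evaluation map `(x, s) ↦ s x`. -/
structure IsExponential {A X Y W P : FinGSet G} (f : A →[G] X) (g : X →[G] Y)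
    (e : W →[G] A) (p : W →[G] P) (q : P →[G] Y) : Prop where
  isPullback : IsPullback (f.comp e) p g q
  existsUnique : ∀ (y : Y) (s : {x : X // g x = y} → A), (∀ x, f (s x) = x.1) →
    ∃! z : P, q z = y ∧ ∀ (w : W) (x : {x : X // g x = y}), p w = z → f (e w) = x.1 → e w = s x

end FinGSet

open FinGSet

/-! ## Tambara functors -/

/-- A `G`-Tambara functor: commutative rings `R(X)` for all finite `G`-sets `X`, with restrictions,
transfers and norms along all maps of finite `G`-sets, which are functorial, send disjoint unions
to products, satisfy base change for all cartesian squares, and satisfy the distributive law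
for all exponential diagrams. (The empty set and disjoint unions `Z = X ⊔ Y` with inclusions
`i`, `j` are covered by `subsingleton_of_isEmpty` and `coprod_bijective`; together with the other
laws they force addition and multiplication to be transfer and norm along fold maps.) -/
structure TambaraFunctor (G : Type u) [Group G] where
  obj : FinGSet G → Type v
  [commRing : ∀ X, CommRing (obj X)]
  res : ∀ {X Y : FinGSet G}, (X →[G] Y) → (obj Y →+* obj X)
  tr : ∀ {X Y : FinGSet G}, (X →[G] Y) → (obj X →+ obj Y)
  nm : ∀ {X Y : FinGSet G}, (X →[G] Y) → (obj X →* obj Y)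
  res_id : ∀ {X : FinGSet G} (a : obj X), res (MulActionHom.id G) a = a
  tr_id : ∀ {X : FinGSet G} (a : obj X), tr (MulActionHom.id G) a = a
  nm_id : ∀ {X : FinGSet G} (a : obj X), nm (MulActionHom.id G) a = a
  res_comp : ∀ {X Y Z : FinGSet G} (g : Y →[G] Z) (f : X →[G] Y) (a : obj Z),
    res (g.comp f) a = res f (res g a)
  tr_comp : ∀ {X Y Z : FinGSet G} (g : Y →[G] Z) (f : X →[G] Y) (a : obj X),
    tr (g.comp f) a = tr g (tr f a)
  nm_comp : ∀ {X Y Z : FinGSet G} (g : Y →[G] Z) (f : X →[G] Y) (a : obj X),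
    nm (g.comp f) a = nm g (nm f a)
  subsingleton_of_isEmpty : ∀ X : FinGSet G, IsEmpty X → Subsingleton (obj X)
  coprod_bijective : ∀ {X Y Z : FinGSet G} (i : X →[G] Z) (j : Y →[G] Z),
    Function.Bijective (Sum.elim i j) →
      Function.Bijective (fun a : obj Z => (res i a, res j a))
  res_tr : ∀ {W X Y Z : FinGSet G} {p : W →[G] X} {q : W →[G] Y} {f : X →[G] Z} {g : Y →[G] Z},
    IsPullback p q f g → ∀ a : obj X, res g (tr f a) = tr q (res p a)
  res_nm : ∀ {W X Y Z : FinGSet G} {p : W →[G] X} {q : W →[G] Y} {f : X →[G] Z} {g : Y →[G] Z},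
    IsPullback p q f g → ∀ a : obj X, res g (nm f a) = nm q (res p a)
  nm_tr : ∀ {A X Y W P : FinGSet G} {f : A →[G] X} {g : X →[G] Y}
    {e : W →[G] A} {p : W →[G] P} {q : P →[G] Y},
    IsExponential f g e p q → ∀ a : obj A, nm g (tr f a) = tr q (nm p (res e a))

namespace TambaraFunctor

section Basic

variable {G : Type u} [Group G]

instance (R : TambaraFunctor.{u, v} G) (X : FinGSet G) : CommRing (R.obj X) := R.commRing X

/-- A morphism of `G`-Tambara functors. -/
structure Hom (R : TambaraFunctor.{u, v} G) (S : TambaraFunctor.{u, w} G) where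
  app : ∀ X : FinGSet G, R.obj X →+* S.obj X
  app_res : ∀ {X Y : FinGSet G} (f : X →[G] Y) (a : R.obj Y),
    app X (R.res f a) = S.res f (app Y a)
  app_tr : ∀ {X Y : FinGSet G} (f : X →[G] Y) (a : R.obj X),
    app Y (R.tr f a) = S.tr f (app X a)
  app_nm : ∀ {X Y : FinGSet G} (f : X →[G] Y) (a : R.obj X),
    app Y (R.nm f a) = S.nm f (app X a)

end Basic

/-! ### Tambara ideals and the Nakaoka spectrum -/

section Ideals

variable {G : Type u} [Group G] [Finite G]

/-- A Tambara ideal: ideals `I(G/H) ⊆ R(G/H)` closed under restrictions, transfers and norms along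
all maps between transitive `G`-sets `G/K → G/H`. (Each such map is the composite of a conjugation
isomorphism and a canonical projection, so this includes closure under conjugations.) -/
@[ext]
structure TambaraIdeal (R : TambaraFunctor.{u, v} G) where
  ideal : ∀ H : Subgroup G, Ideal (R.obj (orbit H))
  res_mem : ∀ {K H : Subgroup G} (f : orbit K →[G] orbit H) {a : R.obj (orbit H)},
    a ∈ ideal H → R.res f a ∈ ideal K
  tr_mem : ∀ {K H : Subgroup G} (f : orbit K →[G] orbit H) {a : R.obj (orbit K)},
    a ∈ ideal K → R.tr f a ∈ ideal H
  nm_mem : ∀ {K H : Subgroup G} (f : orbit K →[G] orbit H) {a : R.obj (orbit K)},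
    a ∈ ideal K → R.nm f a ∈ ideal H

namespace TambaraIdeal

variable {R : TambaraFunctor.{u, v} G}

/-- Tambara ideals are ordered by levelwise inclusion. -/
instance : PartialOrder (TambaraIdeal R) :=
  PartialOrder.lift TambaraIdeal.ideal fun _ _ h => TambaraIdeal.ext h

/-- The intersection of a family of Tambara ideals. -/
instance : InfSet (TambaraIdeal R) where
  sInf S :=
    { ideal := fun H => ⨅ I ∈ S, I.ideal H
      res_mem := fun f a ha => by
        simp only [Submodule.mem_iInf] at ha ⊢
        exact fun I hI => I.res_mem f (ha I hI)
      tr_mem := fun f a ha => by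
        simp only [Submodule.mem_iInf] at ha ⊢
        exact fun I hI => I.tr_mem f (ha I hI)
      nm_mem := fun f a ha => by
        simp only [Submodule.mem_iInf] at ha ⊢
        exact fun I hI => I.nm_mem f (ha I hI) }

/-- The product of two Tambara ideals: the smallest Tambara ideal which contains
`I(G/H) · J(G/H)` for all `H`. -/
instance : Mul (TambaraIdeal R) where
  mul I J := sInf {L | ∀ H, I.ideal H * J.ideal H ≤ L.ideal H}

/-- A Tambara ideal is proper if it is not all of `R`. -/
def IsProper (I : TambaraIdeal R) : Prop := ∃ H, I.ideal H ≠ ⊤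

/-- Prime Tambara ideals. -/
structure IsPrime (p : TambaraIdeal R) : Prop where
  isProper : p.IsProper
  le_or_le : ∀ I J : TambaraIdeal R, I * J ≤ p → I ≤ p ∨ J ≤ p

/-- The contraction of a Tambara ideal along a morphism. -/
def comap {S : TambaraFunctor.{u, w} G} (f : Hom R S) (I : TambaraIdeal S) : TambaraIdeal R where
  ideal H := (I.ideal H).comap (f.app (orbit H))
  res_mem g a ha := by
    rw [Ideal.mem_comap] at ha ⊢
    rw [f.app_res]
    exact I.res_mem g ha
  tr_mem g a ha := by
    rw [Ideal.mem_comap] at ha ⊢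
    rw [f.app_tr]
    exact I.tr_mem g ha
  nm_mem g a ha := by
    rw [Ideal.mem_comap] at ha ⊢
    rw [f.app_nm]
    exact I.nm_mem g ha

end TambaraIdeal

/-- The Nakaoka spectrum: the set of prime Tambara ideals (ordered by inclusion). -/
abbrev Spec (R : TambaraFunctor.{u, v} G) : Type (max u v) := {p : TambaraIdeal R // p.IsPrime}

/-- The topology on the Nakaoka spectrum, generated by the closed subsets
`V(I) = {p | I ⊆ p}`, where `I` runs through all Tambara ideals. -/
instance (R : TambaraFunctor.{u, v} G) : TopologicalSpace (Spec R) :=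
  TopologicalSpace.generateFrom {U | ∃ I : TambaraIdeal R, U = {p : Spec R | I ≤ p.1}ᶜ}

end Ideals

/-! ### The underlying `G`-ring -/

section Bottom

variable {G : Type u} [Group G] [Finite G]

/-- For `x ∈ X` the `G`-map `G/e → X`, `gH ↦ g x` (with `H = e`). For `X = G/e` and `x = g` it is
right multiplication by `g`. -/
def pointMap {X : FinGSet G} (x : X) : orbit (⊥ : Subgroup G) →[G] X where
  toFun := fun c : G ⧸ (⊥ : Subgroup G) => Quotient.liftOn' c (fun g => g • x) (by
    intro a b h
    rw [QuotientGroup.leftRel_apply, Subgroup.mem_bot, inv_mul_eq_one] at h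
    rw [h])
  map_smul' := by
    intro g c
    induction c using QuotientGroup.induction_on with
    | H a => exact mul_smul g a x

/-- The coset of `g` in `G/e`. -/
def elt (g : G) : orbit (⊥ : Subgroup G) := (QuotientGroup.mk g : G ⧸ (⊥ : Subgroup G))

theorem pointMap_elt {X : FinGSet G} (x : X) (g : G) : pointMap x (elt g) = g • x := rfl

theorem exists_elt (c : orbit (⊥ : Subgroup G)) : ∃ g, elt g = c :=
  QuotientGroup.mk_surjective (s := (⊥ : Subgroup G)) c

theorem smul_elt (g h : G) : g • elt h = elt (g * h) := rfl

theorem elt_injective {g h : G} (e : elt g = elt h) : g = h := by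
  have := (QuotientGroup.eq (s := (⊥ : Subgroup G))).1 e
  rwa [Subgroup.mem_bot, inv_mul_eq_one] at this

theorem comp_pointMap {X Y : FinGSet G} (f : X →[G] Y) (x : X) :
    f.comp (pointMap x) = pointMap (f x) := by
  ext c
  obtain ⟨g, rfl⟩ := exists_elt c
  exact map_smul f g x

theorem pointMap_one : pointMap (elt (1 : G)) = MulActionHom.id G := by
  ext c
  obtain ⟨g, rfl⟩ := exists_elt c
  rw [pointMap_elt, smul_elt, mul_one]
  rfl

/-- The commutative ring `R(G/e)`. -/
abbrev bottom (R : TambaraFunctor.{u, v} G) : Type v := R.obj (orbit (⊥ : Subgroup G))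

/-- The action of `G` on `R(G/e)`: the element `g` acts by restriction along right multiplication
by `g` on `G/e`. -/
instance (R : TambaraFunctor.{u, v} G) : MulSemiringAction G R.bottom where
  smul g a := R.res (pointMap (elt g)) a
  one_smul a := by
    change R.res (pointMap (elt (1 : G))) a = a
    rw [pointMap_one, R.res_id]
  mul_smul g h a := by
    change R.res (pointMap (elt (g * h))) a =
      R.res (pointMap (elt g)) (R.res (pointMap (elt h)) a)
    rw [← R.res_comp, comp_pointMap]
    rfl
  smul_zero g := map_zero _
  smul_add g := map_add _
  smul_one g := map_one _
  smul_mul g := map_mul _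

theorem smul_bottom (R : TambaraFunctor.{u, v} G) (g : G) (a : R.bottom) :
    g • a = R.res (pointMap (elt g)) a := rfl

end Bottom

/-! ### Fixed-point Tambara functors -/

section FixedPoints

/-- The product of the values of `a` over the fibre of `f` over `y`. -/
@[to_additive]
def fibreProd {X Y : Type u} {M : Type v} [CommMonoid M] (f : X → Y) (a : X → M) (y : Y) : M :=
  ∏ᶠ x : {x : X // f x = y}, a x.1

@[to_additive]
theorem fibreProd_eq {X Y : Type u} {M : Type v} [CommMonoid M] [Fintype X] [DecidableEq Y]
    (f : X → Y) (a : X → M) (y : Y) : fibreProd f a y = ∏ x with f x = y, a x := by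
  rw [fibreProd, finprod_eq_prod_of_fintype]
  exact (Finset.prod_subtype _ (by simp) a).symm

@[to_additive]
theorem fibreProd_id {X : Type u} {M : Type v} [CommMonoid M] (a : X → M) (y : X) :
    fibreProd (fun x => x) a y = a y := by
  rw [fibreProd, finprod_unique]
  rfl

@[to_additive]
theorem fibreProd_comp {X Y Z : Type u} [Finite X] [Finite Y] {M : Type v} [CommMonoid M]
    (g : Y → Z) (f : X → Y) (a : X → M) (z : Z) :
    fibreProd (fun x => g (f x)) a z = fibreProd g (fibreProd f a) z := by
  classical
  have := Fintype.ofFinite X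
  have := Fintype.ofFinite Y
  simp only [fibreProd_eq]
  rw [← Finset.prod_fiberwise_of_maps_to (t := Finset.univ.filter fun y => g y = z) (g := f)
    (by simp)]
  refine Finset.prod_congr rfl fun y hy => Finset.prod_congr ?_ fun _ _ => rfl
  ext x
  simp only [Finset.mem_filter, Finset.mem_univ, true_and] at hy ⊢
  exact ⟨fun h => h.2, fun h => ⟨h ▸ hy, h⟩⟩

@[to_additive]
theorem fibreProd_mul {X Y : Type u} [Finite X] {M : Type v} [CommMonoid M]
    (f : X → Y) (a b : X → M) (y : Y) :
    fibreProd f (fun x => a x * b x) y = fibreProd f a y * fibreProd f b y := by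
  classical
  have := Fintype.ofFinite X
  simp only [fibreProd_eq, Finset.prod_mul_distrib]

@[to_additive]
theorem fibreProd_cartesian {W X Y Z : Type u} {M : Type v} [CommMonoid M]
    {p : W → X} {q : W → Y} {f : X → Z} {g : Y → Z} (hc : ∀ w, f (p w) = g (q w))
    (h : ∀ x y, f x = g y → ∃! w, p w = x ∧ q w = y) (a : X → M) (y : Y) :
    fibreProd f a (g y) = fibreProd q (fun w => a (p w)) y := by
  symm
  refine finprod_eq_of_bijective
    (fun w : {w // q w = y} => (⟨p w.1, by rw [hc, w.2]⟩ : {x // f x = g y})) ⟨?_, ?_⟩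
    (fun _ => rfl)
  · rintro ⟨w, hw⟩ ⟨w', hw'⟩ e
    have e' : p w = p w' := congrArg Subtype.val e
    obtain ⟨_, _, hu⟩ := h (p w) y (by rw [hc, hw])
    exact Subtype.ext ((hu w ⟨rfl, hw⟩).trans (hu w' ⟨e'.symm, hw'⟩).symm)
  · rintro ⟨x, hx⟩
    obtain ⟨w, ⟨hp, hq⟩, -⟩ := h x y hx
    exact ⟨⟨w, hq⟩, Subtype.ext hp⟩

theorem smul_square {G : Type u} [Group G] {X Y : FinGSet G} (f : X →[G] Y) (g : G) (x : X)
    (y : Y) (h : f x = g • y) : ∃! w : X, g • w = x ∧ f w = y :=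
  ⟨g⁻¹ • x, ⟨smul_inv_smul g x, by rw [map_smul, h, inv_smul_smul]⟩, by
    rintro w ⟨rfl, -⟩
    exact (inv_smul_smul g w).symm⟩

theorem map_fibreProd {X Y : Type u} [Finite X] {M N : Type v} [CommMonoid M] [CommMonoid N]
    (f : X → Y) (a : X → M) (y : Y) (φ : M →* N) :
    φ (fibreProd f a y) = fibreProd f (fun x => φ (a x)) y := by
  classical
  have := Fintype.ofFinite X
  simp only [fibreProd_eq, map_prod]

theorem map_fibreSum {X Y : Type u} [Finite X] {M N : Type v} [AddCommMonoid M] [AddCommMonoid N]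
    (f : X → Y) (a : X → M) (y : Y) (φ : M →+ N) :
    φ (fibreSum f a y) = fibreSum f (fun x => φ (a x)) y := by
  classical
  have := Fintype.ofFinite X
  simp only [fibreSum_eq, map_sum]

theorem fibre_distrib {G : Type u} [Group G] {A X Y W P : FinGSet G} {M : Type v}
    [CommRing M] {f : A →[G] X} {g : X →[G] Y}
    {e : W →[G] A} {p : W →[G] P} {q : P →[G] Y} (h : IsExponential f g e p q)
    (a : A → M) (y : Y) :
    fibreProd g (fibreSum f a) y = fibreSum q (fibreProd p (fun w => a (e w))) y := by
  classical
  have := Fintype.ofFinite A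
  have := Fintype.ofFinite X
  have h1 : fibreProd g (fibreSum f a) y
      = ∑ s : (∀ x : {x : X // g x = y}, {b : A // f b = x.1}), ∏ x, a (s x).1 := by
    rw [fibreProd, finprod_eq_prod_of_fintype]
    simp only [fibreSum, finsum_eq_sum_of_fintype]
    exact Fintype.prod_sum _
  rw [h1, ← finsum_eq_sum_of_fintype]
  unfold fibreSum
  symm
  -- the element of `W` over `x` and `z`
  have hw : ∀ (z : {z : P // q z = y}) (x : {x : X // g x = y}),
      ∃! w : W, f (e w) = x.1 ∧ p w = z.1 := fun z x =>
    h.isPullback.existsUnique x.1 z.1 (by rw [x.2, z.2])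
  choose ω hω hωu using hw
  refine finsum_eq_of_bijective (fun z x => ⟨e (ω z x), (hω z x).1⟩) ⟨?_, ?_⟩ ?_
  · intro z z' hz
    obtain ⟨_, _, hu⟩ := h.existsUnique y (fun x => e (ω z x)) (fun x => (hω z x).1)
    have hz' : ∀ x, e (ω z x) = e (ω z' x) := fun x => congrArg Subtype.val (congrFun hz x)
    refine Subtype.ext ((hu z.1 ⟨z.2, ?_⟩).trans (hu z'.1 ⟨z'.2, ?_⟩).symm)
    · intro w x hpw hfw
      rw [hωu z x w ⟨hfw, hpw⟩]
    · intro w x hpw hfw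
      rw [hωu z' x w ⟨hfw, hpw⟩, hz' x]
  · intro s
    obtain ⟨z, ⟨hz, hs⟩, -⟩ := h.existsUnique y (fun x => (s x).1) (fun x => (s x).2)
    refine ⟨⟨z, hz⟩, funext fun x => Subtype.ext ?_⟩
    exact hs _ x (hω ⟨z, hz⟩ x).2 (hω ⟨z, hz⟩ x).1
  · intro z
    rw [← finprod_eq_prod_of_fintype]
    symm
    refine finprod_eq_of_bijective (fun x => ⟨ω z x, (hω z x).2⟩) ⟨?_, ?_⟩ (fun _ => rfl)
    · intro x x' hx
      refine Subtype.ext ?_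
      rw [← (hω z x).1, ← (hω z x').1]
      exact congrArg (fun w => f (e w)) (congrArg Subtype.val hx)
    · rintro ⟨w, hw⟩
      have hg : g (f (e w)) = y := by
        have := h.isPullback.comm w
        change g (f (e w)) = q (p w) at this
        rw [this, hw, z.2]
      exact ⟨⟨f (e w), hg⟩, Subtype.ext (hωu z ⟨f (e w), hg⟩ w ⟨rfl, hw⟩).symm⟩

variable {G : Type u} [Group G] (S : Type v) [CommRing S] [MulSemiringAction G S]

/-- The ring of `G`-equivariant functions `X → S`, with pointwise operations. For `X = G/H` it is
isomorphic to `S^H` by evaluation at the coset of the identity. -/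
def equivariantFunctions (X : FinGSet G) : Subring (X → S) where
  carrier := {a | ∀ (g : G) (x : X), a (g • x) = g • a x}
  mul_mem' ha hb g x := by simp only [Pi.mul_apply, smul_mul', ha g x, hb g x]
  one_mem' g x := (smul_one g).symm
  add_mem' ha hb g x := by simp only [Pi.add_apply, smul_add, ha g x, hb g x]
  zero_mem' g x := (smul_zero g).symm
  neg_mem' ha g x := by simp only [Pi.neg_apply, smul_neg, ha g x]

variable (G) in
/-- The fixed-point `G`-Tambara functor `FP(S)` of a `G`-ring `S`, with `FP(S)(X)` the ring of
`G`-maps `X → S`; restriction is precomposition, and transfers and norms are given by sums and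
products over the fibres. On transitive `G`-sets this is `FP(S)(G/H) = S^H`, restrictions are the
inclusions, and transfers and norms are the sums and products over cosets. -/
def fixedPoint : TambaraFunctor.{u, max u v} G where
  obj X := equivariantFunctions S X
  res f :=
    { toFun := fun a => ⟨fun x => a.1 (f x), fun g x => by
        change a.1 (f (g • x)) = g • a.1 (f x)
        rw [map_smul, a.2 g (f x)]⟩
      map_one' := rfl
      map_mul' := fun _ _ => rfl
      map_zero' := rfl
      map_add' := fun _ _ => rfl }
  tr f :=
    { toFun := fun a => ⟨fibreSum f a.1, fun g y => by
        rw [fibreSum_cartesian (p := fun x => g • x) (q := f) (g := fun y => g • y)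
          (fun x => map_smul f g x) (smul_square f g), show (fun x => a.1 (g • x)) = fun x => g • a.1 x from funext (a.2 g)]
        exact (map_fibreSum f a.1 y (MulSemiringAction.toRingHom G S g : S →+ S)).symm⟩
      map_zero' := by
        refine Subtype.ext (funext fun y => ?_)
        exact finsum_zero
      map_add' := fun a b => Subtype.ext (funext fun y => fibreSum_add f a.1 b.1 y) }
  nm f :=
    { toFun := fun a => ⟨fibreProd f a.1, fun g y => by
        rw [fibreProd_cartesian (p := fun x => g • x) (q := f) (g := fun y => g • y)
          (fun x => map_smul f g x) (smul_square f g), show (fun x => a.1 (g • x)) = fun x => g • a.1 x from funext (a.2 g)]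
        exact (map_fibreProd f a.1 y (MulSemiringAction.toRingHom G S g : S →* S)).symm⟩
      map_one' := by
        refine Subtype.ext (funext fun y => ?_)
        exact finprod_one
      map_mul' := fun a b => Subtype.ext (funext fun y => fibreProd_mul f a.1 b.1 y) }
  res_id _ := rfl
  tr_id a := Subtype.ext (funext fun y => fibreSum_id a.1 y)
  nm_id a := Subtype.ext (funext fun y => fibreProd_id a.1 y)
  res_comp _ _ _ := rfl
  tr_comp g f a := Subtype.ext (funext fun y => fibreSum_comp g f a.1 y)
  nm_comp g f a := Subtype.ext (funext fun y => fibreProd_comp g f a.1 y)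
  subsingleton_of_isEmpty X hX := ⟨fun a b => Subtype.ext (funext fun x => hX.elim x)⟩
  coprod_bijective {X Y Z} i j hij := by
    constructor
    · intro a b hab
      refine Subtype.ext (funext fun z => ?_)
      obtain ⟨x | y, rfl⟩ := hij.2 z
      · exact congrFun (congrArg (fun c => c.1.1) hab) x
      · exact congrFun (congrArg (fun c => c.2.1) hab) y
    · rintro ⟨a, b⟩
      let φ := Equiv.ofBijective _ hij
      have hl : ∀ x, φ.symm (i x) = Sum.inl x := fun x => φ.symm_apply_apply (Sum.inl x)
      have hr : ∀ x, φ.symm (j x) = Sum.inr x := fun x => φ.symm_apply_apply (Sum.inr x)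
      refine ⟨⟨fun z => Sum.elim a.1 b.1 (φ.symm z), fun g z => ?_⟩, ?_⟩
      · obtain ⟨x | y, rfl⟩ := hij.2 z
        · change Sum.elim a.1 b.1 (φ.symm (g • i x)) = g • Sum.elim a.1 b.1 (φ.symm (i x))
          rw [← map_smul, hl, hl]
          exact a.2 g x
        · change Sum.elim a.1 b.1 (φ.symm (g • j y)) = g • Sum.elim a.1 b.1 (φ.symm (j y))
          rw [← map_smul, hr, hr]
          exact b.2 g y
      · refine Prod.ext (Subtype.ext (funext fun x => ?_)) (Subtype.ext (funext fun x => ?_))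
        · change Sum.elim a.1 b.1 (φ.symm (i x)) = a.1 x
          rw [hl]
          rfl
        · change Sum.elim a.1 b.1 (φ.symm (j x)) = b.1 x
          rw [hr]
          rfl
  res_tr h a := Subtype.ext (funext fun y => fibreSum_cartesian h.comm h.existsUnique a.1 y)
  res_nm h a := Subtype.ext (funext fun y => fibreProd_cartesian h.comm h.existsUnique a.1 y)
  nm_tr h a := Subtype.ext (funext fun y => fibre_distrib h a.1 y)

end FixedPoints

/-! ### The adjunction unit `R → FP(R(G/e))` -/

section Unit

variable {G : Type u} [Group G]

/-- The empty `G`-set. -/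
def emptyGSet : FinGSet G where
  carrier := PEmpty
  action := { smul := fun _ x => x, one_smul := fun _ => rfl, mul_smul := fun _ _ _ => rfl }

/-- The product of a finite `G`-set with a finite set with trivial action. -/
def copies (I : Type u) [Finite I] (Z : FinGSet G) : FinGSet G where
  carrier := I × Z
  action :=
    { smul := fun g x => (x.1, g • x.2)
      one_smul := fun x => Prod.ext rfl (one_smul G x.2)
      mul_smul := fun g h x => Prod.ext rfl (mul_smul g h x.2) }

/-- The inclusion of a copy. -/
def copyIncl {I : Type u} [Finite I] {Z : FinGSet G} (i : I) : Z →[G] copies I Z where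
  toFun z := (i, z)
  map_smul' _ _ := rfl

/-- The fold map. -/
def copyFold {I : Type u} [Finite I] {Z : FinGSet G} : copies I Z →[G] Z where
  toFun z := z.2
  map_smul' _ _ := rfl

theorem res_jointly_injective (R : TambaraFunctor.{u, v} G) (I : Type u) [Finite I] :
    ∀ (Z W : FinGSet G) (ι : I → (Z →[G] W)),
      Function.Bijective (fun x : I × Z => ι x.1 x.2) →
      ∀ b b' : R.obj W, (∀ i, R.res (ι i) b = R.res (ι i) b') → b = b' := by
  refine Finite.induction_empty_option (P := fun I => ∀ (Z W : FinGSet G) (ι : I → (Z →[G] W)),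
      Function.Bijective (fun x : I × Z => ι x.1 x.2) →
      ∀ b b' : R.obj W, (∀ i, R.res (ι i) b = R.res (ι i) b') → b = b') ?_ ?_ ?_ I
  · intro I J e ih Z W ι hι b b' h
    refine ih Z W (fun i => ι (e i)) ?_ b b' fun i => h (e i)
    exact hι.comp (e.prodCongr (Equiv.refl _)).bijective
  · intro Z W ι hι b b' _
    have := R.subsingleton_of_isEmpty W ⟨fun w => by
      obtain ⟨x, -⟩ := hι.2 w
      exact x.1.elim⟩
    exact Subsingleton.elim _ _
  · intro I hI ih Z W ι hι b b' h
    have : Finite I := inferInstance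
    let j : copies I Z →[G] W :=
      { toFun := fun x => ι (some x.1) x.2
        map_smul' := fun g x => map_smul (ι (some x.1)) g x.2 }
    have hj : Function.Bijective (Sum.elim (ι none) j) := by
      constructor
      · rintro (z | ⟨i, z⟩) (z' | ⟨i', z'⟩) hz
        · have := @hι.1 (none, z) (none, z') hz
          simp_all
        · have := @hι.1 (none, z) (some i', z') hz
          simp at this
        · have := @hι.1 (some i, z) (none, z') hz
          simp at this
        · have := @hι.1 (some i, z) (some i', z') hz
          simp_all
      · intro w
        obtain ⟨⟨_ | i, z⟩, rfl⟩ := hι.2 w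
        · exact ⟨Sum.inl z, rfl⟩
        · exact ⟨Sum.inr (i, z), rfl⟩
    refine (R.coprod_bijective (ι none) j hj).1 (Prod.ext (h none) ?_)
    refine ih Z (copies I Z) copyIncl Function.bijective_id _ _ fun i => ?_
    rw [← R.res_comp, ← R.res_comp]
    exact h (some i)

theorem isPullback_copy {I : Type u} [Finite I] {Z : FinGSet G} (i : I) :
    IsPullback (MulActionHom.id G) (MulActionHom.id G)
      (copyIncl (Z := Z) i) (copyIncl (Z := Z) i) where
  comm _ := rfl
  existsUnique x _ h := ⟨x, ⟨rfl, congrArg Prod.snd h⟩, fun _ h => h.1⟩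

theorem isPullback_copy_ne {I : Type u} [Finite I] {Z : FinGSet G} {i j : I} (hij : i ≠ j) :
    IsPullback (W := emptyGSet) ⟨fun x => x.elim, fun _ x => x.elim⟩
      ⟨fun x => x.elim, fun _ x => x.elim⟩
      (copyIncl (Z := Z) i) (copyIncl (Z := Z) j) where
  comm x := PEmpty.elim x
  existsUnique _ _ h := absurd (congrArg Prod.fst h) hij

theorem tr_copyFold (R : TambaraFunctor.{u, v} G) (I : Type u) [Fintype I] (Z : FinGSet G)
    (b : R.obj (copies I Z)) :
    R.tr copyFold b = ∑ i, R.res (copyIncl i) b := by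
  classical
  have hb : b = ∑ i, R.tr (copyIncl i) (R.res (copyIncl i) b) := by
    refine res_jointly_injective R I Z (copies I Z) copyIncl Function.bijective_id _ _ fun j => ?_
    rw [map_sum, Finset.sum_eq_single j]
    · rw [R.res_tr (isPullback_copy j), R.tr_id, R.res_id]
    · intro i _ hij
      rw [R.res_tr (isPullback_copy_ne hij)]
      have := R.subsingleton_of_isEmpty emptyGSet ⟨fun x => PEmpty.elim x⟩
      rw [Subsingleton.elim (R.res _ _) 0, map_zero]
    · simp
  conv_lhs => rw [hb]
  rw [map_sum]
  refine Finset.sum_congr rfl fun i _ => ?_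
  rw [← R.tr_comp]
  exact R.tr_id _

theorem nm_copyFold (R : TambaraFunctor.{u, v} G) (I : Type u) [Fintype I] (Z : FinGSet G)
    (b : R.obj (copies I Z)) :
    R.nm copyFold b = ∏ i, R.res (copyIncl i) b := by
  classical
  have hb : b = ∏ i, R.nm (copyIncl i) (R.res (copyIncl i) b) := by
    refine res_jointly_injective R I Z (copies I Z) copyIncl Function.bijective_id _ _ fun j => ?_
    rw [map_prod, Finset.prod_eq_single j]
    · rw [R.res_nm (isPullback_copy j), R.nm_id, R.res_id]
    · intro i _ hij
      rw [R.res_nm (isPullback_copy_ne hij)]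
      have := R.subsingleton_of_isEmpty emptyGSet ⟨fun x => PEmpty.elim x⟩
      rw [Subsingleton.elim (R.res _ _) 1, map_one]
    · simp
  conv_lhs => rw [hb]
  rw [map_prod]
  refine Finset.prod_congr rfl fun i _ => ?_
  rw [← R.nm_comp]
  exact R.nm_id _

variable [Finite G]

/-- The map from copies of `G/e`, indexed by a fibre of `f`, to the source of `f`. -/
def fibreCover {X Y : FinGSet G} (f : X →[G] Y) (y : Y) :
    copies {x : X // f x = y} (orbit (⊥ : Subgroup G)) →[G] X where
  toFun c := pointMap c.1.1 c.2
  map_smul' g c := map_smul (pointMap c.1.1) g c.2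

theorem isPullback_fibreCover {X Y : FinGSet G} (f : X →[G] Y) (y : Y) :
    IsPullback (fibreCover f y) copyFold f (pointMap y) where
  comm := by
    rintro ⟨⟨x, rfl⟩, c⟩
    exact DFunLike.congr_fun (comp_pointMap f x) c
  existsUnique x c h := by
    obtain ⟨g, rfl⟩ := exists_elt c
    rw [pointMap_elt] at h
    refine ⟨(⟨g⁻¹ • x, by rw [map_smul, h, inv_smul_smul]⟩, elt g), ⟨?_, rfl⟩, ?_⟩
    · exact smul_inv_smul g x
    · rintro ⟨⟨x', hx'⟩, c'⟩ ⟨h1, h2⟩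
      have h2' : c' = elt g := h2
      subst h2'
      have h1' : g • x' = x := h1
      subst h1'
      exact Prod.ext (Subtype.ext (inv_smul_smul g x').symm) rfl

/-- The unit `R → FP(R(G/e))` of the adjunction between evaluation at `G/e` (from `G`-Tambara
functors to `G`-rings) and the fixed-point functor `FP`. It sends `a ∈ R(X)` to the `G`-map
`X → R(G/e)` with value at `x` the restriction of `a` along `G/e → X`, `g ↦ g x`. Under
`FP(R(G/e))(G/H) = R(G/e)^H` it is the restriction along `G/e → G/H`; at `G/e` it is the
identity. -/
def unit (R : TambaraFunctor.{u, v} G) : Hom R (fixedPoint G R.bottom) where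
  app X :=
    { toFun := fun a => ⟨fun x => R.res (pointMap x) a, fun g x => by
        rw [smul_bottom, ← R.res_comp, comp_pointMap]
        rfl⟩
      map_one' := Subtype.ext (funext fun x => map_one _)
      map_mul' := fun a b => Subtype.ext (funext fun x => map_mul _ a b)
      map_zero' := Subtype.ext (funext fun x => map_zero _)
      map_add' := fun a b => Subtype.ext (funext fun x => map_add _ a b) }
  app_res f a := Subtype.ext (funext fun x => by
    change R.res (pointMap x) (R.res f a) = R.res (pointMap (f x)) a
    rw [← R.res_comp, comp_pointMap])
  app_tr {X Y} f a := Subtype.ext (funext fun y => by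
    change R.res (pointMap y) (R.tr f a) = fibreSum f (fun x => R.res (pointMap x) a) y
    have := Fintype.ofFinite {x : X // f x = y}
    rw [R.res_tr (isPullback_fibreCover f y), tr_copyFold, fibreSum, finsum_eq_sum_of_fintype]
    refine Finset.sum_congr rfl fun x _ => ?_
    rw [← R.res_comp]
    rfl)
  app_nm {X Y} f a := Subtype.ext (funext fun y => by
    change R.res (pointMap y) (R.nm f a) = fibreProd f (fun x => R.res (pointMap x) a) y
    have := Fintype.ofFinite {x : X // f x = y}
    rw [R.res_nm (isPullback_fibreCover f y), nm_copyFold, fibreProd, finprod_eq_prod_of_fintype]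
    refine Finset.prod_congr rfl fun x _ => ?_
    rw [← R.res_comp]
    rfl)

end Unit

end TambaraFunctor

end

noncomputable section

/-! ## Constructions with finite `G`-sets -/

namespace FinGSet

variable {G : Type u} [Group G]

/-- The sub-`G`-set carried by an invariant subset. -/
def sub (X : FinGSet G) (s : Set X) (hs : ∀ (g : G) (x : X), x ∈ s → g • x ∈ s) : FinGSet G where
  carrier := s
  action :=
    { smul := fun g x => ⟨g • x.1, hs g x.1 x.2⟩
      one_smul := fun x => Subtype.ext (one_smul G x.1)
      mul_smul := fun g h x => Subtype.ext (mul_smul g h x.1) }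

/-- The inclusion of an invariant subset. -/
def subIncl (X : FinGSet G) (s : Set X) (hs : ∀ (g : G) (x : X), x ∈ s → g • x ∈ s) :
    sub X s hs →[G] X where
  toFun x := x.1
  map_smul' _ _ := rfl

/-- The product of two finite `G`-sets. -/
def prod (X Y : FinGSet G) : FinGSet G where
  carrier := X × Y

/-- The first projection. -/
def fst (X Y : FinGSet G) : prod X Y →[G] X where
  toFun x := x.1
  map_smul' _ _ := rfl

/-- The second projection. -/
def snd (X Y : FinGSet G) : prod X Y →[G] Y where
  toFun x := x.2
  map_smul' _ _ := rfl

/-- The map into a product with given components. -/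
def pair {X Y Z : FinGSet G} (f : Z →[G] X) (g : Z →[G] Y) : Z →[G] prod X Y where
  toFun z := (f z, g z)
  map_smul' a z := Prod.ext (map_smul f a z) (map_smul g a z)

/-- The disjoint union of two finite `G`-sets. -/
def coprod (X Y : FinGSet G) : FinGSet G where
  carrier := X ⊕ Y

/-- The first inclusion. -/
def inl (X Y : FinGSet G) : X →[G] coprod X Y where
  toFun := Sum.inl
  map_smul' _ _ := rfl

/-- The second inclusion. -/
def inr (X Y : FinGSet G) : Y →[G] coprod X Y where
  toFun := Sum.inr
  map_smul' _ _ := rfl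

/-- The map out of a disjoint union with given components. -/
def copair {X Y Z : FinGSet G} (f : X →[G] Z) (g : Y →[G] Z) : coprod X Y →[G] Z where
  toFun := Sum.elim f g
  map_smul' a z := by
    rcases z with x | y
    · exact map_smul f a x
    · exact map_smul g a y

theorem bijective_inl_inr (X Y : FinGSet G) :
    Function.Bijective (Sum.elim (inl X Y) (inr X Y)) := by
  constructor
  · rintro (x | y) (x' | y') h
    · exact h
    · cases h
    · cases h
    · exact h
  · rintro (x | y)
    · exact ⟨Sum.inl x, rfl⟩
    · exact ⟨Sum.inr y, rfl⟩

theorem exists_isPullback {X Y Z : FinGSet G} (f : X →[G] Z) (g : Y →[G] Z) :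
    ∃ (W : FinGSet G) (p : W →[G] X) (q : W →[G] Y), IsPullback p q f g := by
  refine ⟨sub (prod X Y) {z | f z.1 = g z.2} ?_, (fst X Y).comp (subIncl _ _ _),
    (snd X Y).comp (subIncl _ _ _), ⟨fun w => w.2, ?_⟩⟩
  · rintro a ⟨x, y⟩ h
    change f (a • x) = g (a • y)
    rw [map_smul, map_smul]
    exact congrArg _ h
  · intro x y h
    refine ⟨⟨(x, y), h⟩, ⟨rfl, rfl⟩, ?_⟩
    rintro ⟨⟨x', y'⟩, h'⟩ ⟨rfl, rfl⟩
    rfl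

open scoped Pointwise in
/-- The dependent product `Π_g A` of `f : A → X` along `g : X → Y`, with a section over `y`
recorded by its image in `A`. -/
def dependentProduct {A X Y : FinGSet G} (f : A →[G] X) (g : X →[G] Y) : FinGSet G where
  carrier := {z : Y × Set A //
    (∀ a ∈ z.2, g (f a) = z.1) ∧ ∀ x, g x = z.1 → ∃! a, a ∈ z.2 ∧ f a = x}
  action :=
    { smul := fun c z => ⟨(c • z.1.1, c • z.1.2), by
        obtain ⟨⟨y, t⟩, h1, h2⟩ := z
        refine ⟨?_, fun x hx => ?_⟩
        · rintro _ ⟨a, ha, rfl⟩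
          change g (f (c • a)) = c • y
          rw [map_smul, map_smul, h1 a ha]
        · change g x = c • y at hx
          obtain ⟨a, ⟨ha, hax⟩, hu⟩ := h2 (c⁻¹ • x) (by rw [map_smul, hx, inv_smul_smul])
          refine ⟨c • a, ⟨Set.smul_mem_smul_set ha, by rw [map_smul, hax, smul_inv_smul]⟩, ?_⟩
          rintro _ ⟨⟨b, hb, rfl⟩, hbx⟩
          change f (c • b) = x at hbx
          change c • b = c • a
          rw [hu b ⟨hb, by rw [← hbx, map_smul, inv_smul_smul]⟩]⟩
      one_smul := fun z => Subtype.ext (one_smul G z.1)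
      mul_smul := fun c d z => Subtype.ext (mul_smul c d z.1) }

theorem exists_isExponential {A X Y : FinGSet G} (f : A →[G] X) (g : X →[G] Y) :
    ∃ (W P : FinGSet G) (e : W →[G] A) (p : W →[G] P) (q : P →[G] Y),
      IsExponential f g e p q := by
  let P := dependentProduct f g
  let q : P →[G] Y := { toFun := fun z => z.1.1, map_smul' := fun _ _ => rfl }
  let W : FinGSet G := sub (prod A P) {w | w.1 ∈ w.2.1.2} (by
    rintro c ⟨a, z⟩ h
    exact Set.smul_mem_smul_set h)
  refine ⟨W, P, (fst A P).comp (subIncl _ _ _), (snd A P).comp (subIncl _ _ _), q, ⟨?_, ?_⟩, ?_⟩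
  · rintro ⟨⟨a, z⟩, h⟩
    exact z.2.1 a h
  · intro x z h
    obtain ⟨a, ⟨ha, hax⟩, hu⟩ := z.2.2 x h
    refine ⟨⟨(a, z), ha⟩, ⟨hax, rfl⟩, ?_⟩
    rintro ⟨⟨a', z'⟩, h'⟩ ⟨h1, h2⟩
    have h2' : z' = z := h2
    subst h2'
    have : a' = a := hu a' ⟨h', h1⟩
    subst this
    rfl
  · intro y s hs
    let z : P := ⟨(y, Set.range s), by
      rintro _ ⟨x, rfl⟩
      change g (f (s x)) = y
      rw [hs, x.2], fun x hx => ⟨s ⟨x, hx⟩, ⟨⟨_, rfl⟩, hs _⟩, by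
        rintro _ ⟨⟨x', rfl⟩, hx'⟩
        rw [hs] at hx'
        exact congrArg s (Subtype.ext hx')⟩⟩
    refine ⟨z, ⟨rfl, ?_⟩, ?_⟩
    · rintro ⟨⟨a, z'⟩, h⟩ x h1 h2
      have h1' : z' = z := h1
      subst h1'
      have h2' : f a = x.1 := h2
      change a = s x
      obtain ⟨x', hx'⟩ : ∃ x', s x' = a := h
      rw [← hx', hs] at h2'
      rw [← hx', Subtype.ext h2']
    · intro z' hz'
      obtain ⟨⟨⟨y', t⟩, h1, h2⟩, rfl⟩ : ∃ z'', z'' = z' := ⟨z', rfl⟩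
      obtain ⟨rfl, hz''⟩ := hz'
      refine Subtype.ext (Prod.ext rfl ?_)
      change t = Set.range s
      ext a
      constructor
      · intro ha
        have := hz'' ⟨(a, ⟨(y', t), h1, h2⟩), ha⟩ ⟨f a, h1 a ha⟩ rfl rfl
        exact ⟨_, this.symm⟩
      · rintro ⟨x, rfl⟩
        obtain ⟨a, ⟨ha, hax⟩, -⟩ := h2 x.1 x.2
        have : a = s x := hz'' ⟨(a, ⟨(y', t), h1, h2⟩), ha⟩ x rfl hax
        exact this ▸ ha

section Orbits

variable [Finite G]

/-- The coset of the identity in `G/H`. -/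
def base (H : Subgroup G) : orbit H := (QuotientGroup.mk 1 : G ⧸ H)

theorem exists_smul_eq {H : Subgroup G} (x y : orbit H) : ∃ g : G, g • x = y :=
  MulAction.exists_smul_eq (α := G ⧸ H) G x y

theorem surjective_of_orbit {X : FinGSet G} [Nonempty X] {H : Subgroup G} (f : X →[G] orbit H) :
    Function.Surjective f := by
  intro y
  obtain ⟨x⟩ := ‹Nonempty X›
  obtain ⟨g, hg⟩ := exists_smul_eq (f x) y
  exact ⟨g • x, by rw [map_smul, hg]⟩

instance (H : Subgroup G) : Nonempty (orbit H) := ⟨base H⟩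

/-- The inclusion of the orbit of a point. -/
def orbitMap {X : FinGSet G} (x : X) : orbit (MulAction.stabilizer G x) →[G] X where
  toFun := MulAction.ofQuotientStabilizer G x
  map_smul' := MulAction.ofQuotientStabilizer_smul G x

end Orbits
end FinGSet

open FinGSet

/-! ## Sums and products over fibres -/

namespace TambaraFunctor

@[to_additive]
theorem fibreProd_congr_bijective {X X' Y : Type u} {M : Type v} [CommMonoid M] {φ : X' → X}
    (hφ : Function.Bijective φ) (f : X → Y) (a : X → M) (y : Y) :
    fibreProd f a y = fibreProd (fun x => f (φ x)) (fun x => a (φ x)) y := by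
  symm
  refine finprod_eq_of_bijective
    (fun x : {x // f (φ x) = y} => (⟨φ x.1, x.2⟩ : {x // f x = y})) ⟨?_, ?_⟩ (fun _ => rfl)
  · rintro ⟨x, hx⟩ ⟨x', hx'⟩ h
    exact Subtype.ext (hφ.1 (congrArg Subtype.val h))
  · rintro ⟨x, hx⟩
    obtain ⟨x, rfl⟩ := hφ.2 x
    exact ⟨⟨x, hx⟩, rfl⟩

@[to_additive]
theorem fibreProd_sum {X X' Y : Type u} [Finite X] [Finite X'] {M : Type v} [CommMonoid M]
    (f : X ⊕ X' → Y) (a : X ⊕ X' → M) (y : Y) :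
    fibreProd f a y = fibreProd (fun x => f (Sum.inl x)) (fun x => a (Sum.inl x)) y *
      fibreProd (fun x => f (Sum.inr x)) (fun x => a (Sum.inr x)) y := by
  classical
  have := Fintype.ofFinite X
  have := Fintype.ofFinite X'
  simp only [fibreProd_eq, Finset.prod_filter, Fintype.prod_sum_type]

theorem fibreSum_mul_right {X Y : Type u} [Finite X] {M : Type v} [CommRing M]
    (f : X → Y) (a : X → M) (b : Y → M) (y : Y) :
    fibreSum f a y * b y = fibreSum f (fun x => a x * b (f x)) y := by
  classical
  have := Fintype.ofFinite X
  simp only [fibreSum_eq, Finset.sum_mul]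
  refine Finset.sum_congr rfl fun x hx => ?_
  rw [(Finset.mem_filter.1 hx).2]

theorem fibreProd_const {X Y : Type u} [Finite X] {M : Type v} [CommMonoid M]
    (f : X → Y) (a : Y → M) (y : Y) :
    fibreProd f (fun x => a (f x)) y = a y ^ Nat.card {x : X // f x = y} := by
  have := Fintype.ofFinite {x : X // f x = y}
  rw [fibreProd, finprod_eq_prod_of_fintype, Finset.prod_congr rfl (g := fun _ => a y)
    (fun x _ => by rw [x.2]), Finset.prod_const, Finset.card_univ, Nat.card_eq_fintype_card]

theorem fibreSum_mem {X Y : Type u} {M : Type v} [CommRing M] (I : Ideal M)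
    (f : X → Y) (a : X → M) (y : Y) (h : ∀ x, a x ∈ I) : fibreSum f a y ∈ I :=
  finsum_induction (· ∈ I) I.zero_mem (fun _ _ => I.add_mem) fun x => h x.1

theorem fibreProd_mem {X Y : Type u} [Finite X] {M : Type v} [CommRing M] (I : Ideal M)
    (f : X → Y) (a : X → M) (y : Y) (x : X) (hx : f x = y) (h : a x ∈ I) :
    fibreProd f a y ∈ I := by
  have := Fintype.ofFinite {x : X // f x = y}
  rw [fibreProd, finprod_eq_prod_of_fintype]
  exact Ideal.prod_mem I (i := ⟨x, hx⟩) (Finset.mem_univ _) h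

end TambaraFunctor

namespace FinGSet

variable {G : Type u} [Group G]

/-- The cardinality of a fibre is constant along orbits. -/
theorem card_fibre_smul {X Y : FinGSet G} (f : X →[G] Y) (g : G) (y : Y) :
    Nat.card {x : X // f x = g • y} = Nat.card {x : X // f x = y} := by
  refine Nat.card_congr ⟨fun x => ⟨g⁻¹ • x.1, by rw [map_smul, x.2, inv_smul_smul]⟩,
    fun x => ⟨g • x.1, by rw [map_smul, x.2]⟩, fun x => ?_, fun x => ?_⟩
  · exact Subtype.ext (smul_inv_smul g x.1)
  · exact Subtype.ext (inv_smul_smul g x.1)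

theorem IsPullback.card_fibre {W X Y Z : FinGSet G} {p : W →[G] X} {q : W →[G] Y}
    {f : X →[G] Z} {g : Y →[G] Z} (h : IsPullback p q f g) (y : Y) :
    Nat.card {w : W // q w = y} = Nat.card {x : X // f x = g y} := by
  refine Nat.card_congr (Equiv.ofBijective (fun w => ⟨p w.1, by rw [h.comm, w.2]⟩) ⟨?_, ?_⟩)
  · rintro ⟨w, hw⟩ ⟨w', hw'⟩ e
    obtain ⟨_, _, hu⟩ := h.existsUnique (p w) y (by rw [h.comm, hw])
    exact Subtype.ext ((hu w ⟨rfl, hw⟩).trans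
      (hu w' ⟨(congrArg Subtype.val e).symm, hw'⟩).symm)
  · rintro ⟨x, hx⟩
    obtain ⟨w, ⟨hp, hq⟩, -⟩ := h.existsUnique x y hx
    exact ⟨⟨w, hq⟩, Subtype.ext hp⟩

theorem IsPullback.surjective {W X Y Z : FinGSet G} {p : W →[G] X} {q : W →[G] Y}
    {f : X →[G] Z} {g : Y →[G] Z} (h : IsPullback p q f g) (hf : Function.Surjective f) :
    Function.Surjective q := by
  intro y
  obtain ⟨x, hx⟩ := hf (g y)
  obtain ⟨w, ⟨-, hq⟩, -⟩ := h.existsUnique x y hx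
  exact ⟨w, hq⟩

theorem IsPullback.symm {W X Y Z : FinGSet G} {p : W →[G] X} {q : W →[G] Y}
    {f : X →[G] Z} {g : Y →[G] Z} (h : IsPullback p q f g) : IsPullback q p g f where
  comm w := (h.comm w).symm
  existsUnique x y e := by
    obtain ⟨w, ⟨h1, h2⟩, hu⟩ := h.existsUnique y x e.symm
    exact ⟨w, ⟨h2, h1⟩, fun w' h' => hu w' ⟨h'.2, h'.1⟩⟩

variable [Finite G]

theorem orbitMap_injective {X : FinGSet G} (x : X) : Function.Injective (orbitMap x) :=
  MulAction.injective_ofQuotientStabilizer G x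

theorem orbitMap_base {X : FinGSet G} (x : X) : orbitMap x (base _) = x := one_smul G x

theorem exists_orbit_decomposition {X : FinGSet G} (x : X) :
    ∃ (Y : FinGSet G) (j : Y →[G] X), Function.Bijective (Sum.elim (orbitMap x) j) ∧
      Nat.card Y < Nat.card X := by
  let s : Set X := (Set.range (orbitMap x))ᶜ
  have hs : ∀ (g : G) (y : X), y ∈ s → g • y ∈ s := by
    rintro g y hy ⟨c, hc⟩
    exact hy ⟨g⁻¹ • c, by rw [map_smul, hc, inv_smul_smul]⟩
  refine ⟨sub X s hs, subIncl X s hs, ⟨?_, ?_⟩, ?_⟩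
  · rintro (c | y) (c' | y') h
    · exact congrArg Sum.inl (orbitMap_injective x h)
    · exact absurd ⟨c, h⟩ y'.2
    · exact absurd ⟨c', h.symm⟩ y.2
    · exact congrArg Sum.inr (Subtype.ext h)
  · intro y
    by_cases hy : y ∈ Set.range (orbitMap x)
    · obtain ⟨c, rfl⟩ := hy
      exact ⟨Sum.inl c, rfl⟩
    · exact ⟨Sum.inr ⟨y, hy⟩, rfl⟩
  · exact Set.ncard_lt_card (s := s) fun h => (h ▸ Set.mem_univ x : x ∈ s) ⟨base _, orbitMap_base x⟩

end FinGSet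

namespace TambaraFunctor

variable {G : Type u} [Group G] [Finite G] (R : TambaraFunctor.{u, v} G)

/-! ## Values at points -/

/-- The value at a point `x ∈ X` of an element of `R(X)`: its restriction along `G/e → X`. -/
def eval {X : FinGSet G} (x : X) : R.obj X →+* R.bottom := R.res (pointMap x)

theorem eval_res {X Y : FinGSet G} (f : X →[G] Y) (a : R.obj Y) (x : X) :
    R.eval x (R.res f a) = R.eval (f x) a := by
  rw [eval, ← R.res_comp, comp_pointMap]
  rfl

theorem eval_tr {X Y : FinGSet G} (f : X →[G] Y) (a : R.obj X) (y : Y) :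
    R.eval y (R.tr f a) = fibreSum f (fun x => R.eval x a) y :=
  congrFun (congrArg Subtype.val (R.unit.app_tr f a)) y

theorem eval_nm {X Y : FinGSet G} (f : X →[G] Y) (a : R.obj X) (y : Y) :
    R.eval y (R.nm f a) = fibreProd f (fun x => R.eval x a) y :=
  congrFun (congrArg Subtype.val (R.unit.app_nm f a)) y

theorem eval_elt (g : G) (a : R.bottom) : R.eval (elt g) a = g • a := rfl

/-- All restrictions between transitive `G`-sets are injective. -/
def ResInjective : Prop :=
  ∀ (K H : Subgroup G) (f : orbit K →[G] orbit H), Function.Injective (R.res f)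

variable {R}

theorem ResInjective.eval_injective (hR : R.ResInjective) {H : Subgroup G} (x : orbit H) :
    Function.Injective (R.eval x) := hR _ _ _

theorem ResInjective.ext (hR : R.ResInjective) {X : FinGSet G} {a b : R.obj X}
    (h : ∀ x, R.eval x a = R.eval x b) : a = b := by
  induction hn : Nat.card X using Nat.strong_induction_on generalizing X with
  | _ n ih =>
    subst hn
    by_cases hX : Nonempty X
    · obtain ⟨x⟩ := hX
      obtain ⟨Y, j, hj, hlt⟩ := exists_orbit_decomposition x
      refine (R.coprod_bijective _ _ hj).1 (Prod.ext ?_ ?_)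
      · refine hR.eval_injective (base _) ?_
        rw [eval_res, eval_res, h]
      · refine ih _ hlt (fun y => ?_) rfl
        rw [eval_res, eval_res, h]
    · have := R.subsingleton_of_isEmpty X (not_nonempty_iff.1 hX)
      exact Subsingleton.elim a b

/-- Frobenius reciprocity. -/
theorem ResInjective.tr_mul (hR : R.ResInjective) {X Y : FinGSet G} (f : X →[G] Y)
    (a : R.obj X) (b : R.obj Y) : R.tr f a * b = R.tr f (a * R.res f b) := by
  refine hR.ext fun y => ?_
  rw [map_mul, eval_tr, eval_tr, fibreSum_mul_right f _ (fun y => R.eval y b)]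
  congr 1
  funext x
  rw [map_mul, eval_res]

theorem ResInjective.tr_mul_tr (hR : R.ResInjective) {W X Y Z : FinGSet G} {p : W →[G] X}
    {q : W →[G] Y} {f : X →[G] Z} {g : Y →[G] Z} (h : IsPullback p q f g)
    (a : R.obj X) (b : R.obj Y) :
    R.tr f a * R.tr g b = R.tr (f.comp p) (R.res p a * R.res q b) := by
  rw [hR.tr_mul, R.res_tr h.symm, mul_comm, hR.tr_mul, ← R.tr_comp, mul_comm]

theorem ResInjective.tr_eq_add (hR : R.ResInjective) {X X' Y Z : FinGSet G} {i : X →[G] Z}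
    {j : X' →[G] Z} (h : Function.Bijective (Sum.elim i j)) (f : Z →[G] Y) (a : R.obj Z) :
    R.tr f a = R.tr (f.comp i) (R.res i a) + R.tr (f.comp j) (R.res j a) := by
  refine hR.ext fun y => ?_
  simp only [map_add, eval_tr, eval_res]
  rw [fibreSum_congr_bijective h, fibreSum_sum]
  rfl

theorem ResInjective.nm_eq_mul (hR : R.ResInjective) {X X' Y Z : FinGSet G} {i : X →[G] Z}
    {j : X' →[G] Z} (h : Function.Bijective (Sum.elim i j)) (f : Z →[G] Y) (a : R.obj Z) :
    R.nm f a = R.nm (f.comp i) (R.res i a) * R.nm (f.comp j) (R.res j a) := by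
  refine hR.ext fun y => ?_
  simp only [map_mul, eval_nm, eval_res]
  rw [fibreProd_congr_bijective h, fibreProd_sum]
  rfl

/-! ## The extension of a Tambara ideal to all finite `G`-sets -/

namespace TambaraIdeal

/-- The elements of `R(X)` whose restrictions to all orbits lie in `p`. -/
def extend (p : TambaraIdeal R) (X : FinGSet G) : Ideal (R.obj X) :=
  ⨅ (K : Subgroup G) (k : orbit K →[G] X), (p.ideal K).comap (R.res k)

theorem mem_extend {p : TambaraIdeal R} {X : FinGSet G} {a : R.obj X} :
    a ∈ p.extend X ↔ ∀ (K : Subgroup G) (k : orbit K →[G] X), R.res k a ∈ p.ideal K := by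
  simp only [extend, Submodule.mem_iInf, Ideal.mem_comap]

theorem res_mem_extend {p : TambaraIdeal R} {X Y : FinGSet G} (f : X →[G] Y) {a : R.obj Y}
    (h : a ∈ p.extend Y) : R.res f a ∈ p.extend X := by
  rw [mem_extend] at h ⊢
  intro K k
  rw [← R.res_comp]
  exact h K _

theorem tr_mem_of_mem_extend (hR : R.ResInjective) {p : TambaraIdeal R} {X : FinGSet G} {H : Subgroup G}
    (f : X →[G] orbit H) {a : R.obj X} (h : a ∈ p.extend X) : R.tr f a ∈ p.ideal H := by
  induction hn : Nat.card X using Nat.strong_induction_on generalizing X with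
  | _ n ih =>
    subst hn
    by_cases hX : Nonempty X
    · obtain ⟨x⟩ := hX
      obtain ⟨Y, j, hj, hlt⟩ := exists_orbit_decomposition x
      rw [hR.tr_eq_add hj]
      exact (p.ideal H).add_mem (p.tr_mem _ (mem_extend.1 h _ _)) (ih _ hlt _ (res_mem_extend j h) rfl)
    · have := R.subsingleton_of_isEmpty X (not_nonempty_iff.1 hX)
      rw [Subsingleton.elim a 0, map_zero]
      exact (p.ideal H).zero_mem

theorem nm_mem_of_orbitMap (hR : R.ResInjective) {p : TambaraIdeal R} {X : FinGSet G}
    {H : Subgroup G} (f : X →[G] orbit H) {a : R.obj X} (x : X)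
    (h : R.res (orbitMap x) a ∈ p.ideal _) : R.nm f a ∈ p.ideal H := by
  obtain ⟨Y, j, hj, -⟩ := exists_orbit_decomposition x
  rw [hR.nm_eq_mul hj]
  exact Ideal.mul_mem_right _ _ (p.nm_mem _ h)

end TambaraIdeal

end TambaraFunctor

namespace FinGSet

variable {G : Type u} [Group G]

theorem isPullback_inl {X X' Y Y' : FinGSet G} (f : X →[G] Y) (f' : X' →[G] Y') :
    IsPullback (inl X X') f (copair ((inl Y Y').comp f) ((inr Y Y').comp f')) (inl Y Y') where
  comm _ := rfl
  existsUnique := by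
    rintro (x | x') y h
    · exact ⟨x, ⟨rfl, Sum.inl_injective h⟩, fun _ h' => Sum.inl_injective h'.1⟩
    · exact absurd h Sum.inr_ne_inl

theorem isPullback_inr {X X' Y Y' : FinGSet G} (f : X →[G] Y) (f' : X' →[G] Y') :
    IsPullback (inr X X') f' (copair ((inl Y Y').comp f) ((inr Y Y').comp f')) (inr Y Y') where
  comm _ := rfl
  existsUnique := by
    rintro (x | x') y h
    · exact absurd h Sum.inl_ne_inr
    · exact ⟨x', ⟨rfl, Sum.inr_injective h⟩, fun _ h' => Sum.inr_injective h'.1⟩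

end FinGSet

namespace TambaraFunctor

variable {G : Type u} [Group G] [Finite G] {R : TambaraFunctor.{u, v} G}

/-! ## Tambara ideals generated by families closed under restrictions and norms -/

variable (R) in
/-- Subsets of the rings `R(A)` which are closed under restrictions, under norms along
surjections and under disjoint unions. -/
structure NormSystem where
  mem : ∀ A : FinGSet G, Set (R.obj A)
  res_mem : ∀ {A B : FinGSet G} (f : A →[G] B) {x : R.obj B}, x ∈ mem B → R.res f x ∈ mem A
  nm_mem : ∀ {A B : FinGSet G} (f : A →[G] B) {x : R.obj A}, Function.Surjective f →
    x ∈ mem A → R.nm f x ∈ mem B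
  exists_coprod : ∀ {A B : FinGSet G} {x : R.obj A} {y : R.obj B}, x ∈ mem A → y ∈ mem B →
    ∃ z ∈ mem (coprod A B), R.res (inl A B) z = x ∧ R.res (inr A B) z = y
  nonempty_empty : (mem emptyGSet).Nonempty

/-- The Tambara ideal generated by a norm system. It consists of the transfers of multiples of
elements of the system. -/
def NormSystem.generate (M : NormSystem R) (hR : R.ResInjective) : TambaraIdeal R where
  ideal H :=
    { carrier := {y | ∃ (A : FinGSet G) (u : A →[G] orbit H) (c x : R.obj A),
        x ∈ M.mem A ∧ y = R.tr u (c * x)}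
      zero_mem' := by
        obtain ⟨x, hx⟩ := M.nonempty_empty
        exact ⟨emptyGSet, ⟨fun x => x.elim, fun _ x => x.elim⟩, 0, x, hx, by
          rw [zero_mul, map_zero]⟩
      add_mem' := by
        rintro _ _ ⟨A, u, c, x, hx, rfl⟩ ⟨A', u', c', x', hx', rfl⟩
        obtain ⟨z, hz, rfl, rfl⟩ := M.exists_coprod hx hx'
        obtain ⟨d, hd⟩ := (R.coprod_bijective _ _ (bijective_inl_inr A A')).2 (c, c')
        obtain ⟨rfl, rfl⟩ := Prod.ext_iff.1 hd
        refine ⟨coprod A A', copair u u', d, z, hz, ?_⟩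
        rw [hR.tr_eq_add (bijective_inl_inr A A'), map_mul (R.res _), map_mul (R.res _)]
        rfl
      smul_mem' := by
        rintro r _ ⟨A, u, c, x, hx, rfl⟩
        refine ⟨A, u, c * R.res u r, x, hx, ?_⟩
        rw [smul_eq_mul, mul_comm, hR.tr_mul, mul_right_comm] }
  res_mem := by
    rintro K H f _ ⟨A, u, c, x, hx, rfl⟩
    obtain ⟨W, p, q, h⟩ := exists_isPullback u f
    exact ⟨W, q, R.res p c, R.res p x, M.res_mem p hx, by rw [R.res_tr h, map_mul]⟩
  tr_mem := by
    rintro K H f _ ⟨A, u, c, x, hx, rfl⟩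
    exact ⟨A, f.comp u, c, x, hx, (R.tr_comp _ _ _).symm⟩
  nm_mem := by
    rintro K H f _ ⟨A, u, c, x, hx, rfl⟩
    obtain ⟨W, P, e, p, q, h⟩ := exists_isExponential u f
    refine ⟨P, q, R.nm p (R.res e c), R.nm p (R.res e x), M.nm_mem p ?_ (M.res_mem e hx), ?_⟩
    · exact h.isPullback.surjective (surjective_of_orbit f)
    · rw [R.nm_tr h, map_mul, map_mul]

theorem NormSystem.mem_generate (M : NormSystem R) (hR : R.ResInjective) {H : Subgroup G}
    {x : R.obj (orbit H)} (hx : x ∈ M.mem (orbit H)) : x ∈ (M.generate hR).ideal H :=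
  ⟨orbit H, MulActionHom.id G, 1, x, hx, by rw [one_mul, R.tr_id]⟩

theorem NormSystem.generate_le {M : NormSystem R} (hR : R.ResInjective) {p : TambaraIdeal R}
    (h : ∀ (H : Subgroup G) (x : R.obj (orbit H)), x ∈ M.mem (orbit H) → x ∈ p.ideal H) :
    M.generate hR ≤ p := by
  rintro H _ ⟨A, u, c, x, hx, rfl⟩
  refine TambaraIdeal.tr_mem_of_mem_extend hR u (Ideal.mul_mem_left _ _ ?_)
  exact TambaraIdeal.mem_extend.2 fun K k => h K _ (M.res_mem k hx)

theorem TambaraIdeal.mul_le {I J K : TambaraIdeal R}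
    (h : ∀ H, ∀ x ∈ I.ideal H, ∀ y ∈ J.ideal H, x * y ∈ K.ideal H) : I * J ≤ K := by
  intro H
  refine iInf₂_le K fun L => ?_
  exact Ideal.mul_le.2 (h L)

theorem TambaraIdeal.mul_mem_mul {I J : TambaraIdeal R} {H : Subgroup G} {x y : R.obj (orbit H)}
    (hx : x ∈ I.ideal H) (hy : y ∈ J.ideal H) : x * y ∈ (I * J).ideal H := by
  change x * y ∈ ⨅ L ∈ {L : TambaraIdeal R | ∀ H, I.ideal H * J.ideal H ≤ L.ideal H}, L.ideal H
  simp only [Submodule.mem_iInf]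
  exact fun L hL => hL H (Ideal.mul_mem_mul hx hy)

theorem NormSystem.generate_mul_le {M N L : NormSystem R} (hR : R.ResInjective)
    (h : ∀ (A : FinGSet G) (x y : R.obj A), x ∈ M.mem A → y ∈ N.mem A → x * y ∈ L.mem A) :
    M.generate hR * N.generate hR ≤ L.generate hR := by
  refine TambaraIdeal.mul_le ?_
  rintro H _ ⟨A, u, c, x, hx, rfl⟩ _ ⟨A', u', c', x', hx', rfl⟩
  obtain ⟨W, p, q, hW⟩ := exists_isPullback u u'
  refine ⟨W, u.comp p, R.res p c * R.res q c', R.res p x * R.res q x',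
    h W _ _ (M.res_mem p hx) (N.res_mem q hx'), ?_⟩
  rw [hR.tr_mul_tr hW, map_mul (R.res _), map_mul (R.res _), mul_mul_mul_comm]

/-! ## Norms with large fibres -/

/-- The norms of restrictions of `a` along maps all of whose fibres have at least `m` points. -/
def fibreSystem {Z : FinGSet G} (a : R.obj Z) (m : ℕ) : NormSystem R where
  mem A := {y | ∃ (X : FinGSet G) (v : X →[G] A) (w : X →[G] Z),
    (∀ s, m ≤ Nat.card {x : X // v x = s}) ∧ y = R.nm v (R.res w a)}
  res_mem := by
    rintro A B f _ ⟨X, v, w, hv, rfl⟩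
    obtain ⟨W, p, q, h⟩ := exists_isPullback v f
    exact ⟨W, q, w.comp p, fun s => (hv _).trans (h.card_fibre s).ge, by
      rw [R.res_nm h, R.res_comp]⟩
  nm_mem := by
    rintro A B f _ hf ⟨X, v, w, hv, rfl⟩
    refine ⟨X, f.comp v, w, fun s => ?_, (R.nm_comp _ _ _).symm⟩
    obtain ⟨t, rfl⟩ := hf s
    exact (hv t).trans (Nat.card_le_card_of_injective
      (fun x => (⟨x.1, congrArg f x.2⟩ : {x : X // f.comp v x = f t}))
      fun x y h => Subtype.ext (congrArg (fun z => z.1) h))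
  exists_coprod := by
    rintro A B _ _ ⟨X, v, w, hv, rfl⟩ ⟨X', v', w', hv', rfl⟩
    refine ⟨_, ⟨coprod X X', copair ((inl A B).comp v) ((inr A B).comp v'), copair w w', ?_, rfl⟩,
      ?_, ?_⟩
    · rintro (s | s)
      · exact (hv s).trans ((isPullback_inl v v').card_fibre s).le
      · exact (hv' s).trans ((isPullback_inr v v').card_fibre s).le
    · rw [R.res_nm (isPullback_inl v v'), ← R.res_comp]
      rfl
    · rw [R.res_nm (isPullback_inr v v'), ← R.res_comp]
      rfl
  nonempty_empty := ⟨_, emptyGSet, MulActionHom.id G, ⟨fun x => x.elim, fun _ x => x.elim⟩,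
    fun s => s.elim, rfl⟩

theorem fibreSystem_mul (hR : R.ResInjective) {Z : FinGSet G} (a : R.obj Z) {m k : ℕ}
    {A : FinGSet G} {x y : R.obj A} (hx : x ∈ (fibreSystem a m).mem A)
    (hy : y ∈ (fibreSystem a k).mem A) : x * y ∈ (fibreSystem a (m + k)).mem A := by
  obtain ⟨X, v, w, hv, rfl⟩ := hx
  obtain ⟨X', v', w', hv', rfl⟩ := hy
  refine ⟨coprod X X', copair v v', copair w w', fun s => ?_, ?_⟩
  · have hc : Nat.card {x : coprod X X' // copair v v' x = s} =
        Nat.card {x : X // v x = s} + Nat.card {x : X' // v' x = s} :=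
      (Nat.card_congr (Equiv.subtypeSum (p := fun x : X ⊕ X' => copair v v' x = s))).trans
        Nat.card_sum
    rw [hc]
    exact add_le_add (hv s) (hv' s)
  · rw [hR.nm_eq_mul (bijective_inl_inr X X'), ← R.res_comp, ← R.res_comp]
    rfl

theorem self_mem_fibreSystem {Z : FinGSet G} (a : R.obj Z) : a ∈ (fibreSystem a 1).mem Z :=
  ⟨Z, MulActionHom.id G, MulActionHom.id G,
    fun s => Nat.card_pos_iff.2 ⟨⟨s, rfl⟩, inferInstance⟩, by rw [R.res_id, R.nm_id]⟩

theorem TambaraIdeal.IsPrime.mem_of_generate_fibreSystem_le (hR : R.ResInjective)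
    {p : TambaraIdeal R} (hp : p.IsPrime) {H : Subgroup G} (a : R.obj (orbit H)) (m : ℕ)
    (h : (fibreSystem a m).generate hR ≤ p) : a ∈ p.ideal H := by
  induction m with
  | zero =>
    refine h H (NormSystem.mem_generate _ hR ?_)
    obtain ⟨X, v, w, -, h'⟩ := self_mem_fibreSystem a
    exact ⟨X, v, w, fun _ => Nat.zero_le _, h'⟩
  | succ m ih =>
    rcases hp.le_or_le _ _ ((NormSystem.generate_mul_le hR
      fun A x y hx hy => fibreSystem_mul hR a hx hy).trans h) with h' | h'
    · exact ih h'
    · exact h' H (NormSystem.mem_generate _ hR (self_mem_fibreSystem a))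

/-- The norm of a restriction is a power when all fibres have the same cardinality. -/
theorem ResInjective.nm_res (hR : R.ResInjective) {X : FinGSet G} {K : Subgroup G}
    (f : X →[G] orbit K) (a : R.obj (orbit K)) (s : orbit K) :
    R.nm f (R.res f a) = a ^ Nat.card {x : X // f x = s} := by
  refine hR.ext fun t => ?_
  simp only [eval_nm, eval_res, map_pow]
  obtain ⟨g, rfl⟩ := exists_smul_eq s t
  rw [← card_fibre_smul f g s]
  exact fibreProd_const f (fun y => R.eval y a) (g • s)

theorem nm_res_mem_of_pow_mem (hR : R.ResInjective) {p : TambaraIdeal R} {H K : Subgroup G}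
    {a : R.obj (orbit H)} {n : ℕ} (ha : a ^ n ∈ p.ideal H) {X : FinGSet G} (v : X →[G] orbit K)
    (w : X →[G] orbit H) (hv : ∀ s, Nat.card (orbit H) * n ≤ Nat.card {x : X // v x = s}) :
    R.nm v (R.res w a) ∈ p.ideal K := by
  classical
  have := Fintype.ofFinite (orbit H)
  have := Fintype.ofFinite {x : X // v x = base K}
  obtain ⟨b, -, hb⟩ := Finset.exists_le_card_fiber_of_mul_le_card_of_maps_to
    (s := (Finset.univ : Finset {x : X // v x = base K})) (t := (Finset.univ : Finset (orbit H)))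
    (f := fun x => w x.1) (n := n) (fun _ _ => Finset.mem_univ _)
    ⟨base H, Finset.mem_univ _⟩ (by
      have := hv (base K)
      rwa [Nat.card_eq_fintype_card, Nat.card_eq_fintype_card] at this)
  let B := prod (orbit K) (orbit H)
  let z : B := (base K, b)
  have hz : n ≤ Nat.card {x : X // pair v w x = z} := by
    rw [← Fintype.card_subtype, ← Nat.card_eq_fintype_card] at hb
    exact hb.trans (Nat.card_le_card_of_injective
      (fun x => (⟨x.1.1, Prod.ext x.1.2 x.2⟩ : {x : X // pair v w x = z}))
      fun x y h => Subtype.ext (Subtype.ext (congrArg (fun t => t.1) h)))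
  have h1 : R.nm v (R.res w a) = R.nm (fst _ _) (R.nm (pair v w) (R.res w a)) := by
    rw [← R.nm_comp]
    rfl
  rw [h1]
  refine TambaraIdeal.nm_mem_of_orbitMap hR _ z ?_
  obtain ⟨W, q, f, h⟩ := exists_isPullback (pair v w) (orbitMap z)
  have h2 : w.comp q = ((snd _ _).comp (orbitMap z)).comp f :=
    MulActionHom.ext fun x => congrArg Prod.snd (h.comm x)
  rw [R.res_nm h, ← R.res_comp, h2, R.res_comp, hR.nm_res f _ (base _), h.card_fibre, orbitMap_base,
    ← map_pow]
  exact p.res_mem _ (Ideal.pow_mem_of_pow_mem _ ha hz)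

/-- Prime Tambara ideals are levelwise radical. -/
theorem TambaraIdeal.IsPrime.mem_of_pow_mem (hR : R.ResInjective) {p : TambaraIdeal R}
    (hp : p.IsPrime) {H : Subgroup G} {a : R.obj (orbit H)} {n : ℕ} (ha : a ^ n ∈ p.ideal H) :
    a ∈ p.ideal H := by
  refine hp.mem_of_generate_fibreSystem_le hR a (Nat.card (orbit H) * n)
    (NormSystem.generate_le hR ?_)
  rintro K _ ⟨X, v, w, hv, rfl⟩
  exact nm_res_mem_of_pow_mem hR ha v w hv

end TambaraFunctor

/-- If `I` contains the orbit of `x`, then some power of `x` is in the ideal generated by the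
invariants in `I`. -/
theorem exists_pow_mem_of_invariant_mem {G : Type u} [Group G] [Finite G] {S : Type v} [CommRing S]
    [MulSemiringAction G S] {I J : Ideal S}
    (hIJ : ∀ s, (∀ g : G, g • s = s) → s ∈ I → s ∈ J) {x : S} (hx : ∀ g : G, g • x ∈ I) :
    ∃ n, x ^ n ∈ J := by
  have := Fintype.ofFinite G
  let P := MulSemiringAction.charpoly G x
  have hP : P.Monic := MulSemiringAction.monic_charpoly G x
  have hmap : P.map (Ideal.Quotient.mk I) = Polynomial.X ^ Fintype.card G := by
    rw [show P = _ from MulSemiringAction.charpoly_eq G x, Polynomial.map_prod,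
      Finset.prod_congr rfl (g := fun _ => Polynomial.X), Finset.prod_const, Finset.card_univ]
    intro g _
    rw [Polynomial.map_sub, Polynomial.map_X, Polynomial.map_C,
      Ideal.Quotient.eq_zero_iff_mem.2 (hx g), Polynomial.C_0, sub_zero]
  have hc : ∀ i, i ≠ Fintype.card G → P.coeff i ∈ J := by
    intro i hi
    refine hIJ _ (MulSemiringAction.smul_coeff_charpoly x i) ?_
    rw [← Ideal.Quotient.eq_zero_iff_mem, ← Polynomial.coeff_map, hmap, Polynomial.coeff_X_pow,
      if_neg hi]
  refine ⟨P.natDegree, ?_⟩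
  by_cases hd : P.natDegree = Fintype.card G
  · have h0 : P.eval x = 0 := MulSemiringAction.eval_charpoly G x
    rw [hP.as_sum, Polynomial.eval_add, Polynomial.eval_pow, Polynomial.eval_X,
      Polynomial.eval_finsetSum, add_eq_zero_iff_eq_neg] at h0
    rw [h0, J.neg_mem_iff]
    refine J.sum_mem fun i hi => ?_
    rw [Polynomial.eval_mul, Polynomial.eval_C]
    exact J.mul_mem_right _ (hc i (by rw [← hd]; exact (Finset.mem_range.1 hi).ne))
  · have h1 : (1 : S) ∈ J := hP.coeff_natDegree ▸ hc _ hd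
    rw [(Ideal.eq_top_iff_one J).2 h1]
    trivial

instance FixedPoints.isInvariant_subring {G : Type u} [Group G] {S : Type v} [CommRing S]
    [MulSemiringAction G S] : Algebra.IsInvariant (FixedPoints.subring S G) S G where
  isInvariant b h := ⟨⟨b, h⟩, rfl⟩

namespace TambaraFunctor

variable {G : Type u} [Group G] [Finite G] {R : TambaraFunctor.{u, v} G}

/-! ## Tambara ideals induced from ideals of the bottom level -/

/-- The Tambara ideal of all elements with values in a given ideal of `R(G/e)`. -/
def induced (I : Ideal R.bottom) : TambaraIdeal R where
  ideal H := ⨅ x : orbit H, I.comap (R.eval x)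
  res_mem f a ha := by
    simp only [Submodule.mem_iInf, Ideal.mem_comap, eval_res] at ha ⊢
    exact fun x => ha _
  tr_mem f a ha := by
    simp only [Submodule.mem_iInf, Ideal.mem_comap, eval_tr] at ha ⊢
    exact fun y => fibreSum_mem I f _ y ha
  nm_mem f a ha := by
    simp only [Submodule.mem_iInf, Ideal.mem_comap, eval_nm] at ha ⊢
    intro y
    obtain ⟨x, hx⟩ := surjective_of_orbit f y
    exact fibreProd_mem I f _ y x hx (ha x)

theorem mem_induced {I : Ideal R.bottom} {H : Subgroup G} {a : R.obj (orbit H)} :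
    a ∈ (induced I).ideal H ↔ ∀ x, R.eval x a ∈ I := by
  simp only [induced, Submodule.mem_iInf, Ideal.mem_comap]

theorem mem_induced_of_invariant {I : Ideal R.bottom} {a : R.bottom} (ha : ∀ g : G, g • a = a) :
    a ∈ (induced I).ideal ⊥ ↔ a ∈ I := by
  rw [mem_induced]
  constructor
  · intro h
    have := h (elt 1)
    rwa [eval_elt, one_smul] at this
  · intro h x
    obtain ⟨g, rfl⟩ := exists_elt x
    rwa [eval_elt, ha]

theorem TambaraIdeal.eval_mem (p : TambaraIdeal R) {H : Subgroup G} {a : R.obj (orbit H)}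
    (ha : a ∈ p.ideal H) (x : orbit H) : R.eval x a ∈ p.ideal ⊥ :=
  p.res_mem _ ha

theorem TambaraIdeal.smul_mem (p : TambaraIdeal R) {a : R.bottom} (ha : a ∈ p.ideal ⊥) (g : G) :
    g • a ∈ p.ideal ⊥ :=
  p.res_mem _ ha

theorem induced_isPrime (P : Ideal R.bottom) [hP : P.IsPrime] : (induced P).IsPrime where
  isProper := by
    refine ⟨⊥, (Ideal.ne_top_iff_one _).2 fun h => (Ideal.ne_top_iff_one P).1 hP.ne_top ?_⟩
    exact (mem_induced_of_invariant fun g => smul_one g).1 h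
  le_or_le I J h := by
    by_contra! hc
    obtain ⟨hI, hJ⟩ := hc
    have key : ∀ K : TambaraIdeal R, ¬ K ≤ induced P → ∃ a ∈ K.ideal ⊥, a ∉ P := by
      intro K hK
      by_contra! hK'
      exact hK fun H a ha => mem_induced.2 fun x => hK' _ (K.eval_mem ha x)
    obtain ⟨a, ha, ha'⟩ := key I hI
    obtain ⟨b, hb, hb'⟩ := key J hJ
    have hab := mem_induced.1 (h ⊥ (TambaraIdeal.mul_mem_mul ha hb)) (elt 1)
    rw [eval_elt, one_smul] at hab
    exact (hP.mem_or_mem hab).elim ha' hb'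

namespace TambaraIdeal.IsPrime

/-- When restrictions are injective, membership in a prime Tambara ideal can be tested on
values. -/
theorem mem_iff_eval_mem (hR : R.ResInjective) {p : TambaraIdeal R} (hp : p.IsPrime)
    {H : Subgroup G} {a : R.obj (orbit H)} :
    a ∈ p.ideal H ↔ ∀ x, R.eval x a ∈ p.ideal ⊥ := by
  refine ⟨p.eval_mem, fun h => ?_⟩
  refine hp.mem_of_pow_mem hR (n := Nat.card {x // pointMap (base H) x = base H}) ?_
  rw [← hR.nm_res]
  exact p.nm_mem _ (h (base H))

theorem one_notMem (hR : R.ResInjective) {p : TambaraIdeal R} (hp : p.IsPrime) :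
    (1 : R.bottom) ∉ p.ideal ⊥ := by
  intro h
  obtain ⟨H, hH⟩ := hp.isProper
  refine (Ideal.ne_top_iff_one _).1 hH ((hp.mem_iff_eval_mem hR).2 fun x => ?_)
  rwa [map_one]

theorem mem_or_mem_of_invariant (hR : R.ResInjective) {p : TambaraIdeal R} (hp : p.IsPrime)
    {s t : R.bottom} (hs : ∀ g : G, g • s = s) (ht : ∀ g : G, g • t = t)
    (h : s * t ∈ p.ideal ⊥) : s ∈ p.ideal ⊥ ∨ t ∈ p.ideal ⊥ := by
  have hle : induced (Ideal.span {s}) * induced (Ideal.span {t}) ≤ p := by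
    refine TambaraIdeal.mul_le fun H a ha b hb => (hp.mem_iff_eval_mem hR).2 fun x => ?_
    have hm := Ideal.mul_mem_mul (mem_induced.1 ha x) (mem_induced.1 hb x)
    rw [Ideal.span_singleton_mul_span_singleton] at hm
    rw [map_mul]
    exact (Ideal.span_singleton_le_iff_mem _).2 h hm
  refine (hp.le_or_le _ _ hle).imp (fun h' => h' ⊥ ?_) fun h' => h' ⊥ ?_
  · exact (mem_induced_of_invariant hs).2 (Ideal.mem_span_singleton_self s)
  · exact (mem_induced_of_invariant ht).2 (Ideal.mem_span_singleton_self t)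

theorem le_of_invariant (hR : R.ResInjective) {p q : TambaraIdeal R} (hq : q.IsPrime)
    (h : ∀ s : R.bottom, (∀ g : G, g • s = s) → s ∈ p.ideal ⊥ → s ∈ q.ideal ⊥) : p ≤ q := by
  refine fun H a ha => (hq.mem_iff_eval_mem hR).2 fun x => ?_
  obtain ⟨n, hn⟩ := exists_pow_mem_of_invariant_mem h (p.smul_mem (p.eval_mem ha x))
  exact hq.mem_of_pow_mem hR hn

end TambaraIdeal.IsPrime

/-! ## The Nakaoka spectrum when restrictions are injective -/

/-- The invariants at the bottom level of a prime Tambara ideal. -/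
def invariantPrime (hR : R.ResInjective) (p : Spec R) :
    PrimeSpectrum (FixedPoints.subring R.bottom G) where
  asIdeal := (p.1.ideal ⊥).comap (FixedPoints.subring R.bottom G).subtype
  isPrime :=
    { ne_top' := (Ideal.ne_top_iff_one _).2 (p.2.one_notMem hR)
      mem_or_mem' := fun {s t} h => p.2.mem_or_mem_of_invariant hR s.2 t.2 h }

theorem exists_prime_invariantPrime_induced (hR : R.ResInjective)
    (Q : PrimeSpectrum (FixedPoints.subring R.bottom G)) :
    ∃ (P : Ideal R.bottom) (_ : P.IsPrime),
      invariantPrime hR ⟨induced P, induced_isPrime P⟩ = Q := by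
  have : Algebra.IsIntegral (FixedPoints.subring R.bottom G) R.bottom :=
    Algebra.IsInvariant.isIntegral _ _ G
  obtain ⟨P, -, hP, hPQ⟩ := Ideal.exists_ideal_over_prime_of_isIntegral Q.asIdeal
    (⊥ : Ideal R.bottom) (by
      intro s hs
      have : s = 0 := Subtype.ext hs
      exact this ▸ Q.asIdeal.zero_mem)
  refine ⟨P, hP, PrimeSpectrum.ext (Ideal.ext fun s => ?_)⟩
  rw [← hPQ]
  exact mem_induced_of_invariant s.2

theorem invariantPrime_le_iff (hR : R.ResInjective) {p q : Spec R} :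
    invariantPrime hR p ≤ invariantPrime hR q ↔ p ≤ q :=
  ⟨fun h => q.2.le_of_invariant hR fun s hs hp => @h ⟨s, hs⟩ hp, fun h _ hs => h ⊥ hs⟩

/-- The Nakaoka spectrum is isomorphic, as a poset, to the spectrum of `R(G/e)^G`. -/
def specOrderIso (hR : R.ResInjective) :
    Spec R ≃o PrimeSpectrum (FixedPoints.subring R.bottom G) :=
  RelIso.ofSurjective (OrderEmbedding.ofMapLEIff (invariantPrime hR)
    fun _ _ => invariantPrime_le_iff hR) fun Q => by
      obtain ⟨P, hP, h⟩ := exists_prime_invariantPrime_induced hR Q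
      exact ⟨_, h⟩

theorem TambaraIdeal.IsPrime.exists_eq_induced (hR : R.ResInjective) {p : TambaraIdeal R}
    (hp : p.IsPrime) : ∃ (P : Ideal R.bottom) (_ : P.IsPrime), p = induced P := by
  obtain ⟨P, hP, h⟩ := exists_prime_invariantPrime_induced hR (invariantPrime hR ⟨p, hp⟩)
  exact ⟨P, hP, (congrArg Subtype.val ((specOrderIso hR).injective h)).symm⟩

/-! ## Contraction along the unit -/

theorem fixedPoint_resInjective (S : Type v) [CommRing S] [MulSemiringAction G S] :
    (fixedPoint G S).ResInjective := by
  intro K H f a b h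
  refine Subtype.ext (funext fun y => ?_)
  obtain ⟨x, rfl⟩ := surjective_of_orbit f y
  exact congrFun (congrArg Subtype.val h) x

theorem Hom.app_eval {S : TambaraFunctor.{u, w} G} (f : Hom R S) {X : FinGSet G} (x : X)
    (a : R.obj X) : f.app _ (R.eval x a) = S.eval x (f.app X a) :=
  f.app_res _ _

theorem comap_induced {S : TambaraFunctor.{u, w} G} (f : Hom R S) (I : Ideal S.bottom) :
    (induced I).comap f = induced (I.comap (f.app _)) := by
  refine TambaraIdeal.ext (funext fun H => Ideal.ext fun a => ?_)
  rw [mem_induced]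
  change f.app _ a ∈ (induced I).ideal H ↔ _
  rw [mem_induced]
  exact forall_congr' fun x => by rw [Ideal.mem_comap, f.app_eval]

theorem unit_app_bot_bijective (R : TambaraFunctor.{u, v} G) :
    Function.Bijective (R.unit.app (orbit (⊥ : Subgroup G))) := by
  have h1 : ∀ a : R.bottom, (R.unit.app (orbit (⊥ : Subgroup G)) a).1 (elt 1) = a := fun a =>
    (R.eval_elt 1 a).trans (one_smul G a)
  refine ⟨fun a b h => by rw [← h1 a, h, h1 b], fun b => ⟨b.1 (elt 1), ?_⟩⟩
  refine Subtype.ext (funext fun x => ?_)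
  obtain ⟨g, rfl⟩ := exists_elt x
  change g • b.1 (elt 1) = b.1 (elt g)
  rw [← b.2, smul_elt, mul_one]

theorem TambaraIdeal.sInf_le {s : Set (TambaraIdeal R)} {I : TambaraIdeal R} (h : I ∈ s) :
    sInf s ≤ I := fun _ => iInf₂_le I h

theorem TambaraIdeal.comap_mono {S : TambaraFunctor.{u, w} G} (f : Hom R S) {I J : TambaraIdeal S}
    (h : I ≤ J) : I.comap f ≤ J.comap f := fun H => Ideal.comap_mono (h H)

theorem TambaraIdeal.le_comap_sInf {S : TambaraFunctor.{u, w} G} (f : Hom R S) (I : TambaraIdeal R) :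
    I ≤ (sInf {L : TambaraIdeal S | I ≤ L.comap f}).comap f := by
  intro H a ha
  change f.app _ a ∈ ⨅ L ∈ {L : TambaraIdeal S | I ≤ L.comap f}, L.ideal H
  simp only [Submodule.mem_iInf]
  exact fun L hL => hL H ha

theorem continuous_of_eq_comap {S : TambaraFunctor.{u, w} G} (f : Hom R S) (F : Spec S → Spec R)
    (hF : ∀ q, (F q).1 = q.1.comap f) : Continuous F := by
  refine continuous_generateFrom_iff.2 ?_
  rintro _ ⟨I, rfl⟩
  refine TopologicalSpace.isOpen_generateFrom_of_mem
    ⟨sInf {L : TambaraIdeal S | I ≤ L.comap f}, ?_⟩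
  ext q
  simp only [Set.preimage_compl, Set.mem_compl_iff, Set.mem_preimage, Set.mem_ofPred_eq, hF]
  refine not_congr ⟨fun h => TambaraIdeal.sInf_le h, fun h => ?_⟩
  exact (TambaraIdeal.le_comap_sInf f I).trans (TambaraIdeal.comap_mono f h)

theorem comap_unit_isPrime {q : TambaraIdeal (fixedPoint G R.bottom)} (hq : q.IsPrime) :
    (q.comap R.unit).IsPrime := by
  obtain ⟨P, hP, rfl⟩ := hq.exists_eq_induced (fixedPoint_resInjective R.bottom)
  rw [comap_induced]
  exact induced_isPrime _

/-- Contraction of prime Tambara ideals along the unit. -/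
def specUnit (R : TambaraFunctor.{u, v} G) (q : Spec (fixedPoint G R.bottom)) : Spec R :=
  ⟨q.1.comap R.unit, comap_unit_isPrime q.2⟩

theorem specUnit_bijective (hR : R.ResInjective) : Function.Bijective (specUnit R) := by
  constructor
  · intro q q' h
    have hT := fixedPoint_resInjective (G := G) R.bottom
    have hb : ∀ b, b ∈ q.1.ideal ⊥ ↔ b ∈ q'.1.ideal ⊥ := by
      intro b
      obtain ⟨a, rfl⟩ := (unit_app_bot_bijective R).2 b
      have := congrArg (fun p : Spec R => a ∈ p.1.ideal ⊥) h
      exact iff_of_eq this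
    refine Subtype.ext (TambaraIdeal.ext (funext fun H => Ideal.ext fun a => ?_))
    rw [q.2.mem_iff_eval_mem hT, q'.2.mem_iff_eval_mem hT]
    exact forall_congr' fun x => hb _
  · intro p
    obtain ⟨P, hP, h⟩ := p.2.exists_eq_induced hR
    let φ := RingEquiv.ofBijective _ (unit_app_bot_bijective R)
    have hP' : (P.comap φ.symm).IsPrime := Ideal.comap_isPrime _ _
    refine ⟨⟨induced (P.comap φ.symm), induced_isPrime _⟩, Subtype.ext ?_⟩
    change (induced (P.comap φ.symm)).comap R.unit = p.1
    rw [comap_induced, h]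
    congr 1
    ext a
    change φ.symm (φ a) ∈ P ↔ a ∈ P
    rw [φ.symm_apply_apply]

end TambaraFunctor
end

theorem mainTheorem7 {G : Type u} [Group G] [Finite G] (R : TambaraFunctor.{u, v} G)
    (hR : ∀ (K H : Subgroup G) (f : FinGSet.orbit K →[G] FinGSet.orbit H),
      Function.Injective (R.res f)) :
    ∃ F : TambaraFunctor.Spec (TambaraFunctor.fixedPoint G R.bottom) → TambaraFunctor.Spec R,
      (∀ q, (F q).1 = TambaraFunctor.TambaraIdeal.comap R.unit q.1) ∧
      Continuous F ∧ Function.Bijective F ∧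
      ∃ e : TambaraFunctor.Spec R ≃o PrimeSpectrum (FixedPoints.subring R.bottom G),
        ∀ (p : TambaraFunctor.Spec R) (s : FixedPoints.subring R.bottom G),
          s ∈ (e p).asIdeal ↔ (s : R.bottom) ∈ p.1.ideal ⊥ := by
  exact ⟨TambaraFunctor.specUnit R, fun _ => rfl,
    TambaraFunctor.continuous_of_eq_comap R.unit _ fun _ => rfl,
    TambaraFunctor.specUnit_bijective hR, TambaraFunctor.specOrderIso hR, fun _ _ => Iff.rfl⟩
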